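/- Let $(Z,d)$ be a complete, separable, locally compact, geodesic metric space with a base point $e\in Z$ (geodesic: any $x,y\in Z$ are joined by a curve $\gamma:[0,d(x,y)]\to Z$ with $d(\gamma(s),\gamma(t))=|s-t|$). For $p>0$ let $\mathcal M_p(Z)$ be the space of finite signed Borel measures $\mu$ on $Z$ with $\int_Z d(z,e)^p\,d|\mu|(z)<\infty$. On $\mathcal M_1(Z)$ define the norm $$\|\mu\|_{\mathrm{KRu}}=|\mu(Z)|+\sup\Big\{\int_Z f\,d\mu : f:Z\to\mathbb R \text{ is } 1\text{-Lipschitz},\ f(e)=0\Big\},$$ and let $\mathrm{KRu}(Z)$ be the completion of $\mathcal M_1(Z)$ under this norm, so that $\mathcal M_p(Z)\subset\mathcal M_1(Z)\subset\mathrm{KRu}(Z)$ for $p\ge 1$. Let $p>1$, $\alpha>0$, $\beta>0$, and define $G_{\alpha,\beta}:\mathrm{KRu}(Z)\to[0,\infty]$ by $$G_{\alpha,\beta}(\mu)=\alpha\|\mu\|_{\mathrm{KRu}}+\beta\int_Z\big(1+d(z,e)^p\big)\,d|\mu|(z)\quad\text{if }\mu\in\mathcal M_p(Z),$$ and $G_{\alpha,\beta}(\mu)=+\infty$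 otherwise. Let $N$ be a non-negative integer, let $\mathcal A:\mathrm{KRu}(Z)\to\mathbb R^N$ be linear and continuous, and let $F:\mathbb R^N\to(-\infty,+\infty]$ be proper (not identically $+\infty$), convex, lower semicontinuous and coercive ($F(y)\to+\infty$ as $\|y\|\to\infty$). Then the problem $$\inf_{\mu\in\mathrm{KRu}(Z)}F(\mathcal A\mu)+G_{\alpha,\beta}(\mu)$$ has a minimizer $\mu_{\min}\in\mathcal M_p(Z)$ that can be written as $$\mu_{\min}=\sum_{i=1}^N c_i(\delta_{z_i}-\delta_{w_i})+\mu_{\min}(Z)\,\delta_e$$ with $c_i\in\mathbb R$ and $z_i,w_i\in Z$. -/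

import Mathlib

open MeasureTheory Set Filter Topology
open scoped ENNReal NNReal

set_option linter.unusedSectionVars false

namespace KRu

/-- A metric space is geodesic if any two points `x, y` are joined by a curve
`γ : [0, d(x,y)] → Z` with `d(γ(s), γ(t)) = |s - t|`. -/
def IsGeodesic (Z : Type*) [MetricSpace Z] : Prop :=
  ∀ x y : Z, ∃ γ : ℝ → Z, γ 0 = x ∧ γ (dist x y) = y ∧
    ∀ s ∈ Icc (0 : ℝ) (dist x y), ∀ t ∈ Icc (0 : ℝ) (dist x y), dist (γ s) (γ t) = |s - t|

/-- Convexity of an extended real valued function that does not take the value `-∞`. -/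
def IsConvex {H : Type*} [AddCommGroup H] [Module ℝ H] (F : H → EReal) : Prop :=
  ∀ x y : H, ∀ a b : ℝ, 0 < a → 0 < b → a + b = 1 →
    F (a • x + b • y) ≤ (a : EReal) * F x + (b : EReal) * F y

/-- Coercivity: `F(x) → +∞` as `‖x‖ → ∞`. -/
def IsCoercive {H : Type*} [NormedAddCommGroup H] (F : H → EReal) : Prop :=
  Tendsto F (Bornology.cobounded H) (𝓝 ⊤)

variable {Z : Type*} [MetricSpace Z] [MeasurableSpace Z]

/-- The space `M_p(Z)` of finite signed Borel measures `μ` with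
`∫ d(z,e)^p d|μ|(z) < ∞`. -/
noncomputable def momentSpace (e : Z) (p : ℝ) : Submodule ℝ (SignedMeasure Z) where
  carrier := {μ | ∫⁻ z, edist z e ^ p ∂μ.variation < ∞}
  zero_mem' := by simp
  add_mem' := by
    intro μ ν hμ hν
    simp only [mem_ofPred_eq] at *
    refine lt_of_le_of_lt (lintegral_mono' (VectorMeasure.variation_add_le) le_rfl) ?_
    rw [lintegral_add_measure]
    exact ENNReal.add_lt_top.2 ⟨hμ, hν⟩
  smul_mem' := by
    intro c μ hμ
    simp only [mem_ofPred_eq] at *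
    rw [VectorMeasure.variation_smul, lintegral_smul_measure]
    exact ENNReal.mul_lt_top (by simp) hμ

/-- The pairing `∫ f dμ` of a function with a signed measure. -/
noncomputable def pairing (f : Z → ℝ) (μ : SignedMeasure Z) : ℝ :=
  VectorMeasure.integral μ f (ContinuousLinearMap.lsmul ℝ ℝ)

/-- The functions with Lipschitz constant at most one that vanish at the base point. -/
def unitLip₀ (e : Z) : Set (Z → ℝ) := {f | LipschitzWith 1 f ∧ f e = 0}

/-- `‖μ‖_KRu = |μ(Z)| + sup {∫ f dμ : f(e) = 0, L(f) ≤ 1}`. -/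
noncomputable def kruNorm (e : Z) (μ : SignedMeasure Z) : ℝ :=
  |μ univ| + sSup ((fun f => pairing f μ) '' unitLip₀ e)

section norm

open scoped Pointwise

variable [BorelSpace Z] {e : Z}

instance (μ : SignedMeasure Z) : IsFiniteMeasure μ.variation := by
  rw [← SignedMeasure.totalVariation_eq_variation]; infer_instance

lemma integrable_of_mem {f : Z → ℝ} (hf : f ∈ unitLip₀ e) {μ : SignedMeasure Z}
    (hμ : μ ∈ momentSpace e 1) : Integrable f μ.variation := by
  refine ⟨hf.1.continuous.measurable.aestronglyMeasurable, ?_⟩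
  refine lt_of_le_of_lt (lintegral_mono fun z => ?_) hμ
  have h := hf.1.edist_le_mul z e
  rw [hf.2, edist_zero_right] at h
  simpa using h

lemma bddAbove_pairing {μ : SignedMeasure Z} (hμ : μ ∈ momentSpace e 1) :
    BddAbove ((fun f => pairing f μ) '' unitLip₀ e) := by
  refine ⟨(∫⁻ z, edist z e ^ (1 : ℝ) ∂μ.variation).toReal, ?_⟩
  rintro _ ⟨f, hf, rfl⟩
  have h1 : ‖pairing f μ‖ₑ ≤ ∫⁻ z, ‖f z‖ₑ ∂μ.variation := by
    have := VectorMeasure.enorm_integral_le_lintegral_enorm_transpose (μ := μ) (f := f)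
      (B := ContinuousLinearMap.lsmul ℝ ℝ)
    simpa [pairing] using this
  have h2 : ∫⁻ z, ‖f z‖ₑ ∂μ.variation ≤ ∫⁻ z, edist z e ^ (1 : ℝ) ∂μ.variation := by
    refine lintegral_mono fun z => ?_
    have h := hf.1.edist_le_mul z e
    rw [hf.2, edist_zero_right] at h
    simpa using h
  have h3 := ENNReal.toReal_mono (ne_of_lt hμ) (h1.trans h2)
  rw [toReal_enorm] at h3
  exact (le_abs_self _).trans h3

lemma zero_mem_unitLip₀ : (fun _ => (0 : ℝ)) ∈ unitLip₀ e :=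
  ⟨LipschitzWith.const' 0, rfl⟩

lemma pairing_le {μ : SignedMeasure Z} (hμ : μ ∈ momentSpace e 1) {f : Z → ℝ}
    (hf : f ∈ unitLip₀ e) : pairing f μ ≤ sSup ((fun f => pairing f μ) '' unitLip₀ e) :=
  le_csSup (bddAbove_pairing hμ) ⟨f, hf, rfl⟩

lemma pairing_add {f : Z → ℝ} (hf : f ∈ unitLip₀ e) {μ ν : SignedMeasure Z}
    (hμ : μ ∈ momentSpace e 1) (hν : ν ∈ momentSpace e 1) :
    pairing f (μ + ν) = pairing f μ + pairing f ν :=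
  VectorMeasure.integral_add_vectorMeasure (integrable_of_mem hf hμ) (integrable_of_mem hf hν)

lemma pairing_smul (f : Z → ℝ) (c : ℝ) (μ : SignedMeasure Z) :
    pairing f (c • μ) = c * pairing f μ := by
  simp [pairing, VectorMeasure.integral_smul_vectorMeasure]

lemma pairing_neg_fun (f : Z → ℝ) (μ : SignedMeasure Z) :
    pairing (-f) μ = - pairing f μ := by
  exact VectorMeasure.integral_neg (μ := μ) (f := f) (B := ContinuousLinearMap.lsmul ℝ ℝ)

lemma neg_mem_unitLip₀ {f : Z → ℝ} (hf : f ∈ unitLip₀ e) : -f ∈ unitLip₀ e :=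
  ⟨hf.1.neg, by simp [hf.2]⟩

lemma sSup_pairing_nonneg {μ : SignedMeasure Z} (hμ : μ ∈ momentSpace e 1) :
    0 ≤ sSup ((fun f => pairing f μ) '' unitLip₀ e) := by
  refine le_trans (le_of_eq ?_) (pairing_le hμ (zero_mem_unitLip₀ (e := e)))
  exact VectorMeasure.integral_zero.symm

lemma kruNorm_smul (c : ℝ) (μ : SignedMeasure Z) :
    kruNorm e (c • μ) = |c| * kruNorm e μ := by
  have : (fun f => pairing f (c • μ)) '' unitLip₀ e =
      |c| • ((fun f => pairing f μ) '' unitLip₀ e) := by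
    ext r
    simp only [mem_image, Set.mem_smul_set, pairing_smul, exists_exists_and_eq_and, smul_eq_mul]
    rcases abs_choice c with h | h
    · rw [h]
    · rw [h]
      constructor
      · rintro ⟨f, hf, rfl⟩
        exact ⟨-f, neg_mem_unitLip₀ hf, by rw [pairing_neg_fun]; ring⟩
      · rintro ⟨f, hf, rfl⟩
        exact ⟨-f, neg_mem_unitLip₀ hf, by rw [pairing_neg_fun]; ring⟩
  rw [kruNorm, this, Real.sSup_smul_of_nonneg (abs_nonneg c), kruNorm]
  simp [abs_mul, mul_add]

lemma kruNorm_add_le {μ ν : SignedMeasure Z} (hμ : μ ∈ momentSpace e 1)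
    (hν : ν ∈ momentSpace e 1) : kruNorm e (μ + ν) ≤ kruNorm e μ + kruNorm e ν := by
  have h : sSup ((fun f => pairing f (μ + ν)) '' unitLip₀ e) ≤
      sSup ((fun f => pairing f μ) '' unitLip₀ e) +
        sSup ((fun f => pairing f ν) '' unitLip₀ e) := by
    refine csSup_le ⟨_, _, zero_mem_unitLip₀, rfl⟩ ?_
    rintro _ ⟨f, hf, rfl⟩
    simp only [pairing_add hf hμ hν]
    exact add_le_add (pairing_le hμ hf) (pairing_le hν hf)
  have h' := abs_add_le (μ univ) (ν univ)
  simp only [kruNorm, _root_.add_apply]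
  linarith

lemma kruNorm_nonneg {μ : SignedMeasure Z} (hμ : μ ∈ momentSpace e 1) : 0 ≤ kruNorm e μ :=
  add_nonneg (abs_nonneg _) (sSup_pairing_nonneg hμ)

lemma pairing_eq_zero {μ : SignedMeasure Z} (hμ : μ ∈ momentSpace e 1) (h : kruNorm e μ = 0)
    {K : ℝ≥0} (f : Z → ℝ) (hf : LipschitzWith K f) : pairing f μ = 0 := by
  have h0 : μ univ = 0 := by
    have h1 := abs_nonneg (μ univ)
    have h2 := sSup_pairing_nonneg hμ
    rw [kruNorm] at h
    exact abs_eq_zero.1 (by linarith)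
  have hS : sSup ((fun f => pairing f μ) '' unitLip₀ e) = 0 := by
    simpa [kruNorm, h0] using h
  have hz : ∀ g ∈ unitLip₀ e, pairing g μ = 0 := by
    intro g hg
    have h1 := pairing_le hμ hg
    have h2 := pairing_le hμ (neg_mem_unitLip₀ hg)
    rw [pairing_neg_fun] at h2
    linarith
  set L : ℝ := K + 1 with hL
  have hLpos : 0 < L := by positivity
  set g : Z → ℝ := fun z => L⁻¹ * (f z - f e) with hg
  have hgm : g ∈ unitLip₀ e := by
    refine ⟨LipschitzWith.of_dist_le_mul fun x y => ?_, by simp [hg]⟩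
    have h1 := hf.dist_le_mul x y
    rw [Real.dist_eq] at h1 ⊢
    have : g x - g y = L⁻¹ * (f x - f y) := by simp only [hg]; ring
    rw [this, abs_mul, abs_of_pos (inv_pos.2 hLpos), inv_mul_le_iff₀ hLpos]
    have := dist_nonneg (x := x) (y := y)
    simp only [NNReal.coe_one, one_mul]
    nlinarith
  have hfg : f = (L • g) + fun _ => f e := by
    ext z
    simp only [hg, Pi.add_apply, Pi.smul_apply, smul_eq_mul]
    field_simp
    ring
  have hgi := integrable_of_mem hgm hμ
  have h3 : pairing f μ = L * pairing g μ + pairing (fun _ => f e) μ := by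
    conv_lhs => rw [hfg]
    simp only [pairing]
    rw [VectorMeasure.integral_add (VectorMeasure.Integrable.smul L hgi) (integrable_const _),
      VectorMeasure.integral_smul, smul_eq_mul]
  rw [h3, hz g hgm]
  simp [pairing, VectorMeasure.integral_const, h0]

lemma eq_zero_of_kruNorm {μ : SignedMeasure Z} (hμ : μ ∈ momentSpace e 1)
    (h : kruNorm e μ = 0) : μ = 0 := by
  have key : ∀ s : Set Z, IsClosed s → μ s = 0 := by
    intro s hs
    have hδ : ∀ n : ℕ, 0 < (1 : ℝ) / (n + 1) := fun n => by positivity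
    have hlim : Tendsto (fun n : ℕ => pairing (fun z => (thickenedIndicator (hδ n) s z : ℝ)) μ)
        atTop (𝓝 (pairing (s.indicator fun _ => (1 : ℝ)) μ)) := by
      refine VectorMeasure.tendsto_integral_of_dominated_convergence (fun _ => (1 : ℝ)) ?_ ?_ ?_ ?_
      · intro n
        exact (NNReal.continuous_coe.comp
          (thickenedIndicator (hδ n) s).continuous).measurable.aestronglyMeasurable
      · exact integrable_const _
      · intro n
        refine Eventually.of_forall fun z => ?_
        simpa using thickenedIndicator_le_one (hδ n) s z
      · refine Eventually.of_forall fun z => ?_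
        have h1 := thickenedIndicator_tendsto_indicator_closure hδ
          tendsto_one_div_add_atTop_nhds_zero_nat s
        have h2 := (NNReal.continuous_coe.tendsto _).comp (tendsto_pi_nhds.1 h1 z)
        rw [hs.closure_eq] at h2
        refine h2.trans (le_of_eq ?_)
        by_cases hz : z ∈ s <;> simp [hz]
    have hzero : ∀ n : ℕ, pairing (fun z => (thickenedIndicator (hδ n) s z : ℝ)) μ = 0 :=
      fun n => pairing_eq_zero hμ h _
        (K := 1 * (1 / ((n : ℝ) + 1)).toNNReal⁻¹)
        ((LipschitzWith.of_dist_le_mul (fun a b => by simp [NNReal.dist_eq, Real.dist_eq])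
          : LipschitzWith 1 ((↑) : ℝ≥0 → ℝ)).comp (lipschitzWith_thickenedIndicator (hδ n) s))
    simp only [hzero] at hlim
    have h1 := tendsto_nhds_unique hlim tendsto_const_nhds
    have h2 : pairing (s.indicator fun _ => (1 : ℝ)) μ = μ s := by
      rw [pairing, VectorMeasure.integral_indicator hs.measurableSet,
        VectorMeasure.integral_const]
      simp [VectorMeasure.restrict_apply, hs.measurableSet]
    rw [← h2, h1]
  refine VectorMeasure.ext_of_generateFrom {s | IsClosed s} ?_
    (BorelSpace.measurable_eq.trans borel_eq_generateFrom_isClosed) isPiSystem_isClosed ?_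
  · intro s hs
    simpa using key s hs
  · simpa using key univ isClosed_univ

noncomputable instance : Norm (momentSpace e 1) := ⟨fun μ => kruNorm e (μ : SignedMeasure Z)⟩

lemma norm_core : NormedSpace.Core ℝ (momentSpace e 1) where
  norm_nonneg μ := kruNorm_nonneg μ.2
  norm_smul c μ := kruNorm_smul c (μ : SignedMeasure Z)
  norm_triangle μ ν := kruNorm_add_le μ.2 ν.2
  norm_eq_zero_iff μ := by
    refine ⟨fun h => Subtype.ext (eq_zero_of_kruNorm μ.2 h), ?_⟩
    rintro rfl
    have := kruNorm_smul (e := e) 0 (0 : SignedMeasure Z)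
    simp only [zero_smul, abs_zero, zero_mul] at this
    exact this

/-- `M_1(Z)` is a normed space under the unbalanced Kantorovich-Rubinstein norm. -/
noncomputable instance : NormedAddCommGroup (momentSpace e 1) :=
  NormedAddCommGroup.ofCore norm_core

noncomputable instance : NormedSpace ℝ (momentSpace e 1) :=
  NormedSpace.ofCore norm_core

end norm

/-- The space `KRu(Z)`: the completion of `M_1(Z)` under `‖·‖_KRu`. -/
abbrev KRuSpace [BorelSpace Z] (e : Z) : Type _ :=
  UniformSpace.Completion (momentSpace e 1)

section problem

variable [BorelSpace Z]

/-- The regularizer `G_{α,β} : KRu(Z) → [0,∞]`, equal to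
`α ‖μ‖_KRu + β ∫ (1 + d(z,e)^p) d|μ|(z)` if `μ ∈ M_p(Z)`, and to `∞` otherwise.
The infimum is over a set with at most one element; it is `∞` if that set is empty. -/
noncomputable def regularizer (e : Z) (p α β : ℝ) (x : KRuSpace e) : ℝ≥0∞ :=
  ⨅ (μ : momentSpace e 1) (_ : (μ : SignedMeasure Z) ∈ momentSpace e p)
    (_ : (μ : KRuSpace e) = x),
    ENNReal.ofReal (α * ‖μ‖) +
      ENNReal.ofReal β * ∫⁻ z, (1 + edist z e ^ p) ∂(μ : SignedMeasure Z).variation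

lemma regularizer_coe (e : Z) (p α β : ℝ) (μ : momentSpace e 1)
    (hμ : (μ : SignedMeasure Z) ∈ momentSpace e p) :
    regularizer e p α β (μ : KRuSpace e) = ENNReal.ofReal (α * ‖μ‖) +
      ENNReal.ofReal β * ∫⁻ z, (1 + edist z e ^ p) ∂(μ : SignedMeasure Z).variation := by
  refine le_antisymm (iInf₂_le_of_le μ hμ (iInf_le_of_le rfl le_rfl)) ?_
  refine le_iInf fun ν => le_iInf fun _ => le_iInf fun h => ?_
  rw [UniformSpace.Completion.coe_injective _ h]

lemma regularizer_eq_top (e : Z) (p α β : ℝ) (x : KRuSpace e)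
    (hx : ∀ μ : momentSpace e 1, (μ : SignedMeasure Z) ∈ momentSpace e p →
      (μ : KRuSpace e) ≠ x) : regularizer e p α β x = ∞ := by
  simp only [regularizer, iInf_eq_top]
  exact fun μ hμ h => absurd h (hx μ hμ)

/-- The objective functional `F(A x) + G_{α,β}(x)` on `KRu(Z)`. -/
noncomputable def objective {H : Type*} [NormedAddCommGroup H] [InnerProductSpace ℝ H]
    (e : Z) (p α β : ℝ) (A : KRuSpace e →L[ℝ] H) (F : H → EReal) (x : KRuSpace e) : EReal :=
  F (A x) + (regularizer e p α β x : EReal)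

end problem

/-- The Dirac measure at a point, as a signed measure. -/
noncomputable def diracSigned (z : Z) : SignedMeasure Z := VectorMeasure.dirac z 1

end KRu

/-!
The representer theorem is obtained by transporting the problem to the finite dimensional space of
observations, where both existence and sparsity become elementary.

For `x, y : Z` the dipole `δ_x - δ_y` costs at most `α d(x,y) + ψ(x) + ψ(y)` and the Dirac measure
`δ_x` at most `α (1 + d(x,e)) + ψ(x)`, where `ψ = β (1 + d(·,e)^p)`. Dividing by these bounds and
adding negatives and `0` gives the set of atoms. By the Hopf–Rinow theorem
(`IsGeodesic.properSpace`) the space `Z` is proper, and since `p > 1` the atoms tend to `0` as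
their points go to infinity, so the set of atoms is compact in norm (`isCompact_atoms`). Let `B` be
the convex hull of its image under `A`, a compact convex set.

*The observation of a measure of cost `g` lies in `g B`* (`exists_eq_smul_of_cost`). Otherwise the
two are separated by a linear functional. Composed with `A` it is integration of a Lipschitz
function `φ` (`clm_apply_eq_pairing`), and a bound `s` for it on atoms says that
`φ(x) - φ(y) ≤ s (α d(x,y) + ψ(x) + ψ(y))` and `|φ(x)| ≤ s (α (1 + d(x,e)) + ψ(x))`. These are
exactly the conditions under which an `s α`-Lipschitz function `u` with `|u(e)| ≤ s α` fits within
`s ψ` of `φ` (`exists_lipschitzWith_between`); integrating `φ = u + (φ - u)` bounds the functional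
by `s` times the cost (`pairing_le_mul_cost`), a contradiction. This replaces optimal transport
plans and the determination of extreme points.

*Every point of `r B` is the observation of a combination of `N` atoms of cost at most `r`*
(`exists_measure_of_mem_convexHull`). This is Carathéodory's theorem; only `N` atoms are needed,
not `N + 1`, because the weights only have to sum to at most `1`
(`exists_sum_smul_of_mem_convexHull`).

It remains to minimize `F(r b) + r` over `r ≥ 0` and `b ∈ B`, where the minimum is attained because
`F` is lower semicontinuous and bounded below (`exists_min_add_smul`). A combination of `N` atoms
that realizes the minimizing `r b` is a minimizer of the original problem.
-/

namespace KRu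

/-! ### Proper geodesic spaces -/

section HopfRinow

variable {Z : Type*} [MetricSpace Z]

/-- Moving from `z` towards `e` along a geodesic, a ball of radius `r` is reached after a distance
of at most `ε`. -/
lemma IsGeodesic.exists_dist_le (hZ : IsGeodesic Z) (e z : Z) {r ε : ℝ} (hr : 0 ≤ r) (hε : 0 ≤ ε)
    (hz : dist e z ≤ r + ε) : ∃ y, dist y e ≤ r ∧ dist z y ≤ ε := by
  obtain ⟨γ, h0, h1, h⟩ := hZ e z
  rcases le_total (dist e z) r with hle | hle
  · exact ⟨z, by rwa [dist_comm], by simpa using hε⟩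
  · refine ⟨γ r, ?_, ?_⟩
    · have := h r ⟨hr, hle⟩ 0 ⟨le_rfl, dist_nonneg⟩
      rw [h0] at this
      rw [this, sub_zero, abs_of_nonneg hr]
    · have := h (dist e z) ⟨dist_nonneg, le_rfl⟩ r ⟨hr, hle⟩
      rw [h1] at this
      rw [this, abs_of_nonneg (by linarith)]
      linarith

/-- The **Hopf–Rinow theorem** for geodesic metric spaces. The set of radii for which the closed
ball around `e` is compact is closed by completeness and open to the right by local
compactness. -/
theorem IsGeodesic.properSpace [CompleteSpace Z] [LocallyCompactSpace Z] (hZ : IsGeodesic Z)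
    (e : Z) : ProperSpace Z := by
  have key : ∀ R : ℝ, 0 ≤ R → IsCompact (Metric.closedBall e R) := by
    intro R hR
    set S : Set ℝ := {r | IsCompact (Metric.closedBall e r)} with hS
    have mono : ∀ {r s : ℝ}, r ≤ s → s ∈ S → r ∈ S := fun hrs hs =>
      hs.of_isClosed_subset Metric.isClosed_closedBall (Metric.closedBall_subset_closedBall hrs)
    have h0 : (0 : ℝ) ∈ S := by simp [hS]
    -- a ball all of whose smaller concentric balls are compact is totally bounded
    have hlim : ∀ r : ℝ, 0 < r → (∀ s < r, s ∈ S) → r ∈ S := by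
      intro r hr hs
      refine TotallyBounded.isCompact_of_isClosed ?_ Metric.isClosed_closedBall
      rw [Metric.totallyBounded_iff]
      intro ε hε
      set δ := min (ε / 2) r with hδ
      have hδ0 : 0 < δ := lt_min (by linarith) hr
      have hδε : δ ≤ ε / 2 := min_le_left _ _
      obtain ⟨t, ht, hcov⟩ := Metric.totallyBounded_iff.1
        (hs (r - δ) (by linarith)).totallyBounded (ε / 2) (by linarith)
      refine ⟨t, ht, fun z hz => ?_⟩
      obtain ⟨y, hy, hzy⟩ := hZ.exists_dist_le e z (r := r - δ) (ε := δ)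
        (by linarith [min_le_right (ε / 2) r]) hδ0.le
        (by rw [dist_comm]; linarith [Metric.mem_closedBall.1 hz])
      obtain ⟨i, hi, hyi⟩ := mem_iUnion₂.1 (hcov (Metric.mem_closedBall.2 hy))
      refine mem_iUnion₂.2 ⟨i, hi, ?_⟩
      have := dist_triangle z y i
      rw [Metric.mem_ball] at hyi ⊢
      linarith
    -- a ball slightly larger than a compact one lies in a compact neighbourhood of the latter
    have hopen : ∀ r ∈ S, 0 ≤ r → ∃ s > r, s ∈ S := by
      intro r hr hr0
      obtain ⟨K, hK, hrK⟩ := exists_compact_superset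
        (show IsCompact (Metric.closedBall e r) from hr)
      obtain ⟨δ, hδ, hsub⟩ := (show IsCompact (Metric.closedBall e r) from hr
        ).exists_cthickening_subset_open isOpen_interior hrK
      refine ⟨r + δ, by linarith, hK.of_isClosed_subset Metric.isClosed_closedBall ?_⟩
      intro z hz
      obtain ⟨y, hy, hzy⟩ := hZ.exists_dist_le e z hr0 hδ.le
        (by rw [dist_comm]; exact Metric.mem_closedBall.1 hz)
      exact interior_subset (hsub (Metric.mem_cthickening_of_dist_le z y δ _
        (Metric.mem_closedBall.2 hy) hzy))
    have hclosed : IsClosed (S ∩ Icc 0 R) := by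
      refine isClosed_of_closure_subset fun r hr => ?_
      have hrI : r ∈ Icc 0 R := by
        have := closure_mono (inter_subset_right (s := S) (t := Icc 0 R)) hr
        rwa [isClosed_Icc.closure_eq] at this
      refine ⟨?_, hrI⟩
      rcases hrI.1.eq_or_lt with h | h
      · rwa [← h]
      · refine hlim r h fun s hs => ?_
        obtain ⟨u, hu, hu'⟩ := mem_closure_iff.1 hr (Ioi s) isOpen_Ioi hs
        exact mono (le_of_lt hu) hu'.1
    exact hclosed.Icc_subset_of_forall_exists_gt h0 (fun r hr s hs => by
      obtain ⟨u, hu, huS⟩ := hopen r hr.1 hr.2.1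
      have hs' : r < s := hs
      exact ⟨min u s, mono (min_le_left _ _) huS, lt_min hu hs', min_le_right _ _⟩) ⟨hR, le_rfl⟩
  exact ProperSpace.of_seq_closedBall (l := atTop) (x := e) (r := id) tendsto_id
    (eventually_atTop.2 ⟨0, key⟩)

end HopfRinow

/-! ### Convex hulls in finite dimension -/

section Caratheodory

variable {E : Type*} [AddCommGroup E] [Module ℝ E]

/-- A linear version of Carathéodory's theorem: since `0` may be used to absorb weight, linear
rather than affine independence can be achieved, which saves one point. -/
theorem exists_sum_smul_of_mem_convexHull [FiniteDimensional ℝ E] {T : Set E} (hT : (0 : E) ∈ T)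
    {x : E} (hx : x ∈ convexHull ℝ T) {N : ℕ} (hN : Module.finrank ℝ E ≤ N) :
    ∃ (c : Fin N → ℝ) (t : Fin N → E), (∀ i, 0 ≤ c i) ∧ ∑ i, c i ≤ 1 ∧ (∀ i, t i ∈ T) ∧
      ∑ i, c i • t i = x := by
  classical
  have key : ∀ (n : ℕ) (s : Finset E), s.card = n → (s : Set E) ⊆ T →
      (∃ w : E → ℝ, (∀ y ∈ s, 0 ≤ w y) ∧ ∑ y ∈ s, w y ≤ 1 ∧ ∑ y ∈ s, w y • y = x) →
      ∃ s' : Finset E, s'.card ≤ N ∧ (s' : Set E) ⊆ T ∧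
      ∃ w : E → ℝ, (∀ y ∈ s', 0 ≤ w y) ∧ ∑ y ∈ s', w y ≤ 1 ∧ ∑ y ∈ s', w y • y = x := by
    intro n
    induction n with
    | zero => exact fun s hs hsT hw => ⟨s, by omega, hsT, hw⟩
    | succ n ih =>
      rintro s hs hsT ⟨w, hw0, hw1, hwx⟩
      by_cases hsN : s.card ≤ N
      · exact ⟨s, hsN, hsT, w, hw0, hw1, hwx⟩
      obtain ⟨g, hg0, hgs, y0, hy0, hgy0⟩ :
          ∃ g : E → ℝ, ∑ y ∈ s, g y • y = 0 ∧ 0 ≤ ∑ y ∈ s, g y ∧ ∃ y ∈ s, 0 < g y := by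
        obtain ⟨g, hg, y, hy, hgy⟩ := Module.exists_nontrivial_relation_of_finrank_lt_card
          (R := ℝ) (t := s) (by omega)
        wlog hs0 : 0 ≤ ∑ y ∈ s, g y generalizing g
        · exact this (-g) (by simp [hg]) (by simpa using hgy)
            (by simp only [Pi.neg_apply, Finset.sum_neg_distrib]; linarith)
        refine ⟨g, hg, hs0, ?_⟩
        by_contra! hneg
        have hz := (Finset.sum_eq_zero_iff_of_nonpos hneg).1
          (le_antisymm (Finset.sum_nonpos hneg) hs0)
        exact hgy (hz y hy)
      -- subtract the largest multiple of the relation that keeps all weights nonnegative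
      obtain ⟨y1, hy1, hmin⟩ := Finset.exists_min_image (s.filter fun y => 0 < g y)
        (fun y => w y / g y) ⟨y0, by simp [hy0, hgy0]⟩
      rw [Finset.mem_filter] at hy1
      set τ := w y1 / g y1 with hτ
      have hτ0 : 0 ≤ τ := div_nonneg (hw0 _ hy1.1) hy1.2.le
      set w' : E → ℝ := fun y => w y - τ * g y with hw'
      have hy1' : w' y1 = 0 := by
        simp only [hw', hτ]
        rw [div_mul_cancel₀ _ hy1.2.ne', sub_self]
      have hx' : ∑ y ∈ s, w' y • y = x := by
        simp only [hw', sub_smul, mul_smul, Finset.sum_sub_distrib, ← Finset.smul_sum, hg0, hwx]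
        simp
      have hs' : ∑ y ∈ s, w' y ≤ 1 := by
        simp only [hw', Finset.sum_sub_distrib, ← Finset.mul_sum]
        nlinarith
      have h0' : ∀ y ∈ s, 0 ≤ w' y := by
        intro y hy
        simp only [hw', sub_nonneg]
        rcases le_or_gt (g y) 0 with h | h
        · exact (mul_nonpos_of_nonneg_of_nonpos hτ0 h).trans (hw0 y hy)
        · have := hmin y (by simp [hy, h])
          rwa [le_div_iff₀ h] at this
      refine ih (s.erase y1) (by rw [Finset.card_erase_of_mem hy1.1]; omega)
        ((Finset.coe_subset.2 (Finset.erase_subset _ _)).trans hsT)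
        ⟨w', fun y hy => h0' y (Finset.mem_of_mem_erase hy), ?_, ?_⟩
      · rwa [Finset.sum_erase _ hy1']
      · rwa [Finset.sum_erase _ (by simp [hy1'])]
  obtain ⟨s, hsT, hxs⟩ : ∃ s : Finset E, (s : Set E) ⊆ T ∧ x ∈ convexHull ℝ (s : Set E) := by
    rw [convexHull_eq_union_convexHull_finite_subsets] at hx
    simpa using hx
  obtain ⟨w, hw0, hw1, hwx⟩ := Finset.mem_convexHull'.1 hxs
  obtain ⟨s, hsN, hsT, w, hw0, hw1, hwx⟩ := key _ s rfl hsT ⟨w, hw0, hw1.le, hwx⟩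
  -- pad the family with the point `0` and weight `0` to index it by `Fin N`
  have emb : Nonempty (s ↪ Fin N) := by
    rw [Function.Embedding.nonempty_iff_card_le]
    simpa using hsN
  obtain ⟨j⟩ := emb
  have hc : ∀ y : s, Function.extend j (fun y => w y) 0 (j y) = w y := j.injective.extend_apply _ _
  have ht : ∀ y : s, Function.extend j (fun y => (y : E)) 0 (j y) = y :=
    j.injective.extend_apply _ _
  have hc' : ∀ i ∉ range j, Function.extend j (fun y => w y) 0 i = 0 :=
    fun i hi => Function.extend_apply' _ _ _ hi
  have ht' : ∀ i ∉ range j, Function.extend j (fun y => (y : E)) 0 i = 0 :=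
    fun i hi => Function.extend_apply' _ _ _ hi
  refine ⟨Function.extend j (fun y => w y) 0, Function.extend j (fun y => (y : E)) 0,
    fun i => ?_, ?_, fun i => ?_, ?_⟩
  · by_cases hi : i ∈ range j
    · obtain ⟨y, rfl⟩ := hi
      rw [hc]; exact hw0 y y.2
    · rw [hc' i hi]
  · rw [← Fintype.sum_of_injective j j.injective (fun y => w y) _ hc' fun y => (hc y).symm,
      Finset.sum_coe_sort s w]
    exact hw1
  · by_cases hi : i ∈ range j
    · obtain ⟨y, rfl⟩ := hi
      rw [ht]; exact hsT y.2
    · rw [ht' i hi]; exact hT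
  · rw [← hwx, ← Finset.sum_coe_sort s fun y => w y • y]
    refine (Fintype.sum_of_injective j j.injective _ _ (fun i hi => ?_) fun y => ?_).symm
    · rw [hc' i hi, zero_smul]
    · rw [hc, ht]

/-- In finite dimension the convex hull of a compact set containing `0` is compact. -/
theorem isCompact_convexHull_of_zero_mem {E : Type*} [NormedAddCommGroup E] [NormedSpace ℝ E]
    [FiniteDimensional ℝ E] {T : Set E} (hT : (0 : E) ∈ T) (hc : IsCompact T) :
    IsCompact (convexHull ℝ T) := by
  set N := Module.finrank ℝ E
  set P : Set ((Fin N → ℝ) × (Fin N → E)) :=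
    ({c | ∑ i, c i ≤ 1} ∩ univ.pi fun _ => Icc 0 1) ×ˢ univ.pi fun _ => T
  have hP : IsCompact P := by
    refine IsCompact.prod (IsCompact.inter_left (isCompact_univ_pi fun _ => isCompact_Icc) ?_)
      (isCompact_univ_pi fun _ => hc)
    exact isClosed_le (by fun_prop) continuous_const
  have himage : convexHull ℝ T =
      (fun q : (Fin N → ℝ) × (Fin N → E) => ∑ i, q.1 i • q.2 i) '' P := by
    refine Subset.antisymm (fun x hx => ?_) ?_
    · obtain ⟨c, t, hc0, hc1, ht, hx⟩ := exists_sum_smul_of_mem_convexHull hT hx le_rfl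
      exact ⟨(c, t), ⟨⟨hc1, fun i _ => ⟨hc0 i,
        (Finset.single_le_sum (fun j _ => hc0 j) (Finset.mem_univ i)).trans hc1⟩⟩,
        fun i _ => ht i⟩, hx⟩
    · rintro _ ⟨⟨c, t⟩, ⟨⟨hc1, hc⟩, ht⟩, rfl⟩
      have hc0 : ∀ i, 0 ≤ c i := fun i => (hc i (mem_univ i)).1
      have := (convex_convexHull ℝ T).sum_mem (t := Finset.univ)
        (w := fun o : Option (Fin N) => o.elim (1 - ∑ i, c i) c) (z := fun o => o.elim 0 t)
        (by rintro (_ | i) _ <;> simp_all) (by simp [Fintype.sum_option])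
        (by
          rintro (_ | i) _
          · exact subset_convexHull ℝ T hT
          · exact subset_convexHull ℝ T (ht i (mem_univ i)))
      simpa [Fintype.sum_option] using this
  rw [himage]
  exact hP.image (by fun_prop)

end Caratheodory

/-! ### Lipschitz sandwich -/

/-- A Lipschitz function fits between `l` and `h` as soon as the pointwise compatibility condition
holds; it is the largest `L`-Lipschitz minorant of `h`. -/
theorem exists_lipschitzWith_between {X : Type*} [PseudoMetricSpace X] {l h : X → ℝ} (L : ℝ≥0)
    (hlh : ∀ x y, l x ≤ h y + L * dist x y) :
    ∃ u : X → ℝ, LipschitzWith L u ∧ (∀ x, l x ≤ u x) ∧ ∀ x, u x ≤ h x := by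
  have hbdd : ∀ x, BddBelow (range fun y => h y + L * dist x y) :=
    fun x => ⟨l x, by rintro _ ⟨y, rfl⟩; exact hlh x y⟩
  refine ⟨fun x => ⨅ y, (h y + L * dist x y), LipschitzWith.of_le_add_mul L fun x x' => ?_,
    fun x => ?_, fun x => ?_⟩
  · have : Nonempty X := ⟨x⟩
    rw [← sub_le_iff_le_add]
    refine le_ciInf fun y => ?_
    rw [sub_le_iff_le_add]
    refine (ciInf_le (hbdd x) y).trans ?_
    nlinarith [dist_triangle x x' y, L.coe_nonneg]
  · have : Nonempty X := ⟨x⟩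
    exact le_ciInf fun y => hlh x y
  · simpa using ciInf_le (hbdd x) x

/-! ### A finite dimensional minimization problem -/

section Minimization

/-- A coercive lower semicontinuous function that avoids `⊥` is bounded below. -/
lemma IsCoercive.exists_le {H : Type*} [NormedAddCommGroup H] [ProperSpace H] {F : H → EReal}
    (hF : IsCoercive F) (hlsc : LowerSemicontinuous F) (hbot : ∀ y, F y ≠ ⊥) :
    ∃ m : ℝ, ∀ y, (m : EReal) ≤ F y := by
  have hpos : ∀ᶠ y in Bornology.cobounded H, (0 : EReal) < F y :=
    hF.eventually (lt_mem_nhds EReal.zero_lt_top)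
  obtain ⟨r, hr⟩ := (Metric.isBounded_iff_subset_closedBall (0 : H)).1
    (Bornology.isBounded_def.2 (by rwa [compl_compl] : {y | (0 : EReal) < F y}ᶜᶜ ∈ _))
  obtain ⟨y0, -, hmin⟩ := LowerSemicontinuousOn.exists_isMinOn
    (s := Metric.closedBall (0 : H) (max r 0))
    ⟨0, by simp⟩ (isCompact_closedBall _ _) (hlsc.lowerSemicontinuousOn _)
  obtain ⟨m, hm⟩ : ∃ m : ℝ, (m : EReal) ≤ F y0 := by
    rcases eq_or_ne (F y0) ⊤ with h | h
    · exact ⟨0, by simp [h]⟩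
    · exact ⟨(F y0).toReal, (EReal.coe_toReal h (hbot y0)).le⟩
  refine ⟨min m 0, fun y => ?_⟩
  by_cases hy : 0 < F y
  · exact le_trans (by exact_mod_cast min_le_right m 0) hy.le
  · refine le_trans (le_trans (by exact_mod_cast min_le_left m 0) hm) (hmin ?_)
    exact Metric.closedBall_subset_closedBall (le_max_left _ _) (hr hy)

/-- Minimizing `F(r • b) + r` over `r ≥ 0` and `b` in a compact set: since `F ≥ m`, values of `r`
exceeding the objective at one point by more than `-m` are irrelevant. The minimum may be `⊤`. -/
theorem exists_min_add_smul {H : Type*} [NormedAddCommGroup H] [NormedSpace ℝ H]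
    {F : H → EReal} (hlsc : LowerSemicontinuous F) {m : ℝ} (hm : ∀ y, (m : EReal) ≤ F y)
    {B : Set H} (hB : IsCompact B) (hne : B.Nonempty) :
    ∃ r : ℝ, 0 ≤ r ∧ ∃ b ∈ B, ∀ s : ℝ, 0 ≤ s → ∀ b' ∈ B,
      F (r • b) + (r : EReal) ≤ F (s • b') + (s : EReal) := by
  set Φ : ℝ × H → EReal := fun q => F (q.1 • q.2) + (q.1 : EReal) with hΦ
  have hbot : ∀ y, F y ≠ ⊥ := fun y h => by
    have := hm y
    rw [h, le_bot_iff] at this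
    exact EReal.coe_ne_bot _ this
  have hΦlsc : LowerSemicontinuous Φ := by
    refine LowerSemicontinuous.add' (hlsc.comp (by fun_prop))
      (continuous_coe_real_ereal.comp continuous_fst).lowerSemicontinuous fun q => ?_
    exact EReal.continuousAt_add (Or.inr (EReal.coe_ne_bot _)) (Or.inr (EReal.coe_ne_top _))
  by_cases htop : ∀ s : ℝ, 0 ≤ s → ∀ b ∈ B, Φ (s, b) = ⊤
  · obtain ⟨b, hb⟩ := hne
    refine ⟨0, le_rfl, b, hb, fun s hs b' hb' => ?_⟩
    rw [show F (s • b') + (s : EReal) = ⊤ from htop s hs b' hb']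
    exact le_top
  · push Not at htop
    obtain ⟨s0, hs0, b0, hb0, hfin⟩ := htop
    have hF0 : F (s0 • b0) ≠ ⊤ := fun h => hfin (by simp [hΦ, h])
    set v := (F (s0 • b0)).toReal with hv
    have hv' : F (s0 • b0) = (v : EReal) := (EReal.coe_toReal hF0 (hbot _)).symm
    have hmv : m ≤ v := by exact_mod_cast hv' ▸ hm (s0 • b0)
    set R := v + s0 - m with hR
    obtain ⟨⟨r, b⟩, ⟨hr, hb⟩, hmin⟩ := LowerSemicontinuousOn.exists_isMinOn
      (s := Icc (0 : ℝ) R ×ˢ B) ⟨(s0, b0), ⟨hs0, by linarith⟩, hb0⟩ (isCompact_Icc.prod hB)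
      (hΦlsc.lowerSemicontinuousOn _)
    refine ⟨r, hr.1, b, hb, fun s hs b' hb' => ?_⟩
    rcases le_or_gt s R with h | h
    · exact hmin (a := (s, b')) ⟨⟨hs, h⟩, hb'⟩
    · calc Φ (r, b) ≤ Φ (s0, b0) := hmin (a := (s0, b0)) ⟨⟨hs0, by linarith⟩, hb0⟩
        _ = ((v + s0 : ℝ) : EReal) := by simp only [hΦ, hv', EReal.coe_add]
        _ ≤ ((m + s : ℝ) : EReal) := by exact_mod_cast (by linarith)
        _ = (m : EReal) + s := EReal.coe_add _ _
        _ ≤ F (s • b') + s := add_le_add_left (hm _) _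

end Minimization

variable {Z : Type*} [MetricSpace Z] [MeasurableSpace Z] [BorelSpace Z] {e : Z}

/-! ### Dirac measures in the Kantorovich–Rubinstein space -/

lemma variation_diracSigned (z : Z) : (diracSigned z).variation = Measure.dirac z := by
  simp [diracSigned]

lemma diracSigned_mem (e z : Z) {q : ℝ} (hq : 0 ≤ q) : diracSigned z ∈ momentSpace e q := by
  change ∫⁻ x, edist x e ^ q ∂(diracSigned z).variation < ∞
  rw [variation_diracSigned, lintegral_dirac]
  exact ENNReal.rpow_lt_top_of_nonneg hq (edist_ne_top _ _)

/-- The Dirac measure at a point as an element of `M_1(Z)`. -/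
noncomputable def diracM (e z : Z) : momentSpace e 1 :=
  ⟨diracSigned z, diracSigned_mem e z zero_le_one⟩

lemma pairing_diracSigned (f : Z → ℝ) (z : Z) : pairing f (diracSigned z) = f z := by
  simp [pairing, diracSigned]

lemma norm_eq_kruNorm (μ : momentSpace e 1) : ‖μ‖ = kruNorm e (μ : SignedMeasure Z) := rfl

lemma pairing_le_norm (μ : momentSpace e 1) {f : Z → ℝ} (hf : f ∈ unitLip₀ e) :
    pairing f μ ≤ ‖μ‖ := by
  have := pairing_le μ.2 hf
  rw [norm_eq_kruNorm, kruNorm]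
  linarith [abs_nonneg ((μ : SignedMeasure Z) univ)]

lemma abs_pairing_le_norm (μ : momentSpace e 1) {f : Z → ℝ} (hf : f ∈ unitLip₀ e) :
    |pairing f μ| ≤ ‖μ‖ := by
  refine abs_le'.2 ⟨pairing_le_norm μ hf, ?_⟩
  rw [← pairing_neg_fun]
  exact pairing_le_norm μ (neg_mem_unitLip₀ hf)

lemma abs_apply_univ_le_norm (μ : momentSpace e 1) : |(μ : SignedMeasure Z) univ| ≤ ‖μ‖ := by
  have := sSup_pairing_nonneg μ.2
  rw [norm_eq_kruNorm, kruNorm]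
  linarith

lemma norm_le_of_forall_pairing_le (μ : momentSpace e 1) {a b : ℝ}
    (ha : |(μ : SignedMeasure Z) univ| ≤ a) (hb : ∀ f ∈ unitLip₀ e, pairing f μ ≤ b) :
    ‖μ‖ ≤ a + b := by
  rw [norm_eq_kruNorm, kruNorm]
  refine add_le_add ha (csSup_le ⟨_, _, zero_mem_unitLip₀, rfl⟩ ?_)
  rintro _ ⟨f, hf, rfl⟩
  exact hb f hf

lemma diracSigned_univ (z : Z) : diracSigned z univ = 1 := by
  simp [diracSigned]

lemma pairing_sub {f : Z → ℝ} (hf : f ∈ unitLip₀ e) (μ ν : momentSpace e 1) :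
    pairing f ((μ - ν : momentSpace e 1) : SignedMeasure Z) = pairing f μ - pairing f ν :=
  VectorMeasure.integral_sub_vectorMeasure (integrable_of_mem hf μ.2) (integrable_of_mem hf ν.2)

lemma norm_diracM_sub_le (x y : Z) : ‖diracM e x - diracM e y‖ ≤ dist x y := by
  rw [← zero_add (dist x y)]
  refine norm_le_of_forall_pairing_le _ (by simp [diracM, diracSigned_univ]) fun f hf => ?_
  rw [pairing_sub hf]
  simp only [diracM, pairing_diracSigned]
  have := hf.1.dist_le_mul x y
  rw [Real.dist_eq, NNReal.coe_one, one_mul] at this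
  exact (le_abs_self _).trans this

lemma norm_diracM_le (z : Z) : ‖diracM e z‖ ≤ 1 + dist z e := by
  refine norm_le_of_forall_pairing_le _ (by simp [diracM, diracSigned_univ]) fun f hf => ?_
  simp only [diracM, pairing_diracSigned]
  have := hf.1.dist_le_mul z e
  rw [Real.dist_eq, NNReal.coe_one, one_mul, hf.2, sub_zero] at this
  exact (le_abs_self _).trans this

lemma lipschitzWith_diracM : LipschitzWith 1 (diracM e) :=
  LipschitzWith.of_dist_le_mul fun x y => by
    simpa [dist_eq_norm] using norm_diracM_sub_le x y

/-! ### Continuous functionals as integrals -/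

/-- Pairing with a function of `unitLip₀ e`, extended to the completion. -/
noncomputable def pairingCLM {f : Z → ℝ} (hf : f ∈ unitLip₀ e) : KRuSpace e →L[ℝ] ℝ :=
  (LinearMap.mkContinuous
    { toFun := fun μ : momentSpace e 1 => pairing f (μ : SignedMeasure Z)
      map_add' := fun μ ν => pairing_add hf μ.2 ν.2
      map_smul' := fun c μ => pairing_smul f c μ } 1
    fun μ => by simpa using abs_pairing_le_norm μ hf).extend
    UniformSpace.Completion.toComplL

/-- The total mass, extended to the completion. -/
noncomputable def massCLM (e : Z) : KRuSpace e →L[ℝ] ℝ :=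
  (LinearMap.mkContinuous
    { toFun := fun μ : momentSpace e 1 => (μ : SignedMeasure Z) univ
      map_add' := fun μ ν => rfl
      map_smul' := fun c μ => rfl } 1
    fun μ => by rw [one_mul]; exact abs_apply_univ_le_norm μ).extend
    UniformSpace.Completion.toComplL

lemma pairingCLM_coe {f : Z → ℝ} (hf : f ∈ unitLip₀ e) (μ : momentSpace e 1) :
    pairingCLM hf (μ : KRuSpace e) = pairing f μ :=
  ContinuousLinearMap.extend_eq _ (UniformSpace.Completion.denseRange_coe)
    (UniformSpace.Completion.isUniformInducing_coe _) μ

lemma massCLM_coe (μ : momentSpace e 1) :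
    massCLM e (μ : KRuSpace e) = (μ : SignedMeasure Z) univ :=
  ContinuousLinearMap.extend_eq _ (UniformSpace.Completion.denseRange_coe)
    (UniformSpace.Completion.isUniformInducing_coe _) μ

lemma abs_pairingCLM_le {f : Z → ℝ} (hf : f ∈ unitLip₀ e) (x : KRuSpace e) :
    |pairingCLM hf x| ≤ ‖x‖ := by
  induction x using UniformSpace.Completion.induction_on with
  | hp => exact isClosed_le (by fun_prop) (by fun_prop)
  | ih μ =>
    rw [pairingCLM_coe, UniformSpace.Completion.norm_coe]
    exact abs_pairing_le_norm μ hf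

lemma abs_massCLM_le (x : KRuSpace e) : |massCLM e x| ≤ ‖x‖ := by
  induction x using UniformSpace.Completion.induction_on with
  | hp => exact isClosed_le (by fun_prop) (by fun_prop)
  | ih μ =>
    rw [massCLM_coe, UniformSpace.Completion.norm_coe]
    exact abs_apply_univ_le_norm μ

/-- The total mass and the pairings with Lipschitz functions separate the points of `KRu(Z)`,
not only those of `M_1(Z)`: they are uniformly bounded on the unit ball and norming on a dense
subspace. -/
lemma eq_zero_of_massCLM_of_pairingCLM {x : KRuSpace e} (hm : massCLM e x = 0)
    (hp : ∀ (f : Z → ℝ) (hf : f ∈ unitLip₀ e), pairingCLM hf x = 0) : x = 0 := by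
  rw [← norm_le_zero_iff]
  refine le_of_forall_pos_le_add fun ε hε => ?_
  obtain ⟨_, ⟨μ, rfl⟩, hy⟩ := Metric.mem_closure_iff.1
    (UniformSpace.Completion.denseRange_coe (α := momentSpace e 1) x) (ε / 3) (by positivity)
  rw [dist_comm, dist_eq_norm] at hy
  have hμ : ‖μ‖ ≤ ε / 3 + ε / 3 := by
    refine norm_le_of_forall_pairing_le μ ?_ fun f hf => ?_
    · have := abs_massCLM_le ((μ : KRuSpace e) - x)
      rw [map_sub, hm, sub_zero, massCLM_coe] at this
      exact this.trans hy.le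
    · have := abs_pairingCLM_le hf ((μ : KRuSpace e) - x)
      rw [map_sub, hp f hf, sub_zero, pairingCLM_coe] at this
      exact (le_abs_self _).trans (this.trans hy.le)
  have h1 := norm_sub_norm_le x (μ : KRuSpace e)
  rw [UniformSpace.Completion.norm_coe, norm_sub_rev] at h1
  linarith

section Separable

variable [TopologicalSpace.SeparableSpace Z]

lemma integrable_diracM (μ : momentSpace e 1) :
    VectorMeasure.Integrable (μ : SignedMeasure Z) fun z => (diracM e z : KRuSpace e) := by
  have : SecondCountableTopology Z := UniformSpace.secondCountable_of_separable Z
  have hcont : Continuous fun z => (diracM e z : KRuSpace e) :=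
    (UniformSpace.Completion.continuous_coe _).comp lipschitzWith_diracM.continuous
  refine ⟨hcont.stronglyMeasurable.aestronglyMeasurable, ?_⟩
  have hle : ∀ z, ‖(diracM e z : KRuSpace e)‖ₑ ≤ 1 + edist z e ^ (1 : ℝ) := by
    intro z
    rw [ENNReal.rpow_one, edist_dist, ← ENNReal.ofReal_one, ← ENNReal.ofReal_add zero_le_one
      dist_nonneg, ← ofReal_norm, UniformSpace.Completion.norm_coe]
    exact ENNReal.ofReal_le_ofReal (norm_diracM_le z)
  refine (lintegral_mono hle).trans_lt ?_
  rw [lintegral_add_left measurable_const, lintegral_one]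
  exact ENNReal.add_lt_top.2 ⟨measure_lt_top _ _, μ.2⟩

/-- A continuous linear functional commutes with the vector integral of the Dirac measures. -/
lemma clm_integral_diracM (L : KRuSpace e →L[ℝ] ℝ) (μ : momentSpace e 1) :
    L (VectorMeasure.integral (μ : SignedMeasure Z) (fun z => (diracM e z : KRuSpace e))
      (ContinuousLinearMap.lsmul ℝ ℝ).flip) = pairing (fun z => L (diracM e z)) μ := by
  rw [VectorMeasure.continuousLinearMap_apply_integral (integrable_diracM μ), pairing,
    VectorMeasure.integral_continuousLinearMap_comp (integrable_diracM μ)]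
  congr 1
  ext x
  simp

/-- An element of `M_1(Z)` is the integral of Dirac measures, as an integral in `KRu(Z)`. -/
lemma integral_diracM (μ : momentSpace e 1) :
    VectorMeasure.integral (μ : SignedMeasure Z) (fun z => (diracM e z : KRuSpace e))
      (ContinuousLinearMap.lsmul ℝ ℝ).flip = μ := by
  rw [← sub_eq_zero]
  refine eq_zero_of_massCLM_of_pairingCLM ?_ fun f hf => ?_
  · rw [map_sub, clm_integral_diracM, massCLM_coe]
    simp [massCLM_coe, diracM, diracSigned_univ, pairing, VectorMeasure.integral_const]
  · rw [map_sub, clm_integral_diracM, pairingCLM_coe]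
    simp [pairingCLM_coe, diracM, pairing_diracSigned]

/-- A continuous linear functional on `KRu(Z)` acts on `M_1(Z)` as integration of its values at
Dirac measures. -/
theorem clm_apply_eq_pairing (L : KRuSpace e →L[ℝ] ℝ) (μ : momentSpace e 1) :
    L μ = pairing (fun z => L (diracM e z)) μ := by
  rw [← clm_integral_diracM, integral_diracM]

end Separable

/-! ### The cost of a measure -/

variable {p α β : ℝ}

/-- The value of `G_{α,β}` on `M_p(Z)`, defined by the same formula on all of `M_1(Z)`, where it
is infinite outside of `M_p(Z)`. -/
noncomputable def cost (e : Z) (p α β : ℝ) (μ : momentSpace e 1) : ℝ≥0∞ :=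
  ENNReal.ofReal (α * ‖μ‖) +
    ENNReal.ofReal β * ∫⁻ z, (1 + edist z e ^ p) ∂(μ : SignedMeasure Z).variation

lemma cost_add_le (hα : 0 < α) (μ ν : momentSpace e 1) :
    cost e p α β (μ + ν) ≤ cost e p α β μ + cost e p α β ν := by
  have h1 : ENNReal.ofReal (α * ‖μ + ν‖) ≤
      ENNReal.ofReal (α * ‖μ‖) + ENNReal.ofReal (α * ‖ν‖) := by
    rw [← ENNReal.ofReal_add (by positivity) (by positivity), ← mul_add]
    gcongr
    exact norm_add_le _ _
  have h2 : ∫⁻ z, (1 + edist z e ^ p) ∂((μ + ν : momentSpace e 1) : SignedMeasure Z).variation ≤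
      ∫⁻ z, (1 + edist z e ^ p) ∂(μ : SignedMeasure Z).variation +
        ∫⁻ z, (1 + edist z e ^ p) ∂(ν : SignedMeasure Z).variation := by
    rw [← lintegral_add_measure]
    exact lintegral_mono' VectorMeasure.variation_add_le le_rfl
  calc _ ≤ _ := add_le_add h1 (mul_le_mul_right h2 _)
    _ = _ := by rw [mul_add, cost, cost]; abel

lemma cost_smul (c : ℝ) (μ : momentSpace e 1) :
    cost e p α β (c • μ) = ENNReal.ofReal |c| * cost e p α β μ := by
  have h : ‖c‖ₑ = ENNReal.ofReal |c| := by rw [← ofReal_norm, Real.norm_eq_abs]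
  rw [cost, cost, norm_smul, Submodule.coe_smul, VectorMeasure.variation_smul,
    lintegral_smul_measure, mul_add, ← ENNReal.ofReal_mul (abs_nonneg c), Real.norm_eq_abs,
    ENNReal.smul_def, smul_eq_mul, ← enorm_eq_nnnorm, h]
  congr 1
  · congr 1; ring
  · ring

lemma cost_zero : cost e p α β (0 : momentSpace e 1) = 0 := by
  simpa using cost_smul (e := e) (p := p) (α := α) (β := β) 0 0

lemma cost_sum_le (hα : 0 < α) {ι : Type*} (s : Finset ι) (μ : ι → momentSpace e 1) :
    cost e p α β (∑ i ∈ s, μ i) ≤ ∑ i ∈ s, cost e p α β (μ i) :=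
  Finset.le_sum_of_subadditive _ cost_zero.le (cost_add_le hα) _ _

lemma lintegral_weight (μ : SignedMeasure Z) : ∫⁻ z, (1 + edist z e ^ p) ∂μ.variation =
    μ.variation univ + ∫⁻ z, edist z e ^ p ∂μ.variation := by
  rw [lintegral_add_left measurable_const, lintegral_one]

lemma cost_lt_top_iff (hβ : 0 < β) (μ : momentSpace e 1) :
    cost e p α β μ < ∞ ↔ (μ : SignedMeasure Z) ∈ momentSpace e p := by
  rw [cost, lintegral_weight, ENNReal.add_lt_top]
  change _ ↔ ∫⁻ z, edist z e ^ p ∂(μ : SignedMeasure Z).variation < ∞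
  refine ⟨fun h => ?_, fun h => ⟨ENNReal.ofReal_lt_top, ENNReal.mul_lt_top ENNReal.ofReal_lt_top
    (ENNReal.add_lt_top.2 ⟨measure_lt_top _ _, h⟩)⟩⟩
  rcases ENNReal.mul_lt_top_iff.1 h.2 with h | h | h
  · exact (ENNReal.add_lt_top.1 h.2).2
  · simp at h; linarith
  · rw [add_eq_zero] at h
    rw [h.2]; exact ENNReal.zero_lt_top

/-! ### Atoms -/

/-- The weight `β (1 + d(z,e)^p)` by which `G_{α,β}` penalizes mass at `z`. -/
noncomputable def weight (e : Z) (p β : ℝ) (z : Z) : ℝ := β * (1 + dist z e ^ p)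

lemma weight_pos (hβ : 0 < β) (z : Z) : 0 < weight e p β z :=
  mul_pos hβ (by linarith [Real.rpow_nonneg (dist_nonneg (x := z) (y := e)) p])

lemma continuous_weight (hp : 0 ≤ p) : Continuous (weight e p β) := by
  unfold weight
  exact continuous_const.mul (continuous_const.add
    ((continuous_id.dist continuous_const).rpow_const fun _ => Or.inr hp))

lemma ofReal_weight (hp : 0 ≤ p) (hβ : 0 ≤ β) (z : Z) :
    ENNReal.ofReal (weight e p β z) = ENNReal.ofReal β * (1 + edist z e ^ p) := by
  rw [weight, ENNReal.ofReal_mul hβ, ENNReal.ofReal_add zero_le_one (by positivity), edist_dist,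
    ENNReal.ofReal_rpow_of_nonneg dist_nonneg hp, ENNReal.ofReal_one]

lemma cost_le_of_variation_le (hα : 0 < α) {μ : momentSpace e 1} {ν : Measure Z} {a : ℝ}
    (hμ : (μ : SignedMeasure Z).variation ≤ ν) (ha : ‖μ‖ ≤ a) :
    cost e p α β μ ≤ ENNReal.ofReal (α * a) + ENNReal.ofReal β * ∫⁻ z, (1 + edist z e ^ p) ∂ν := by
  rw [cost]
  gcongr

lemma cost_diracM_sub_le (hp : 0 ≤ p) (hα : 0 < α) (hβ : 0 < β) (x y : Z) :
    cost e p α β (diracM e x - diracM e y) ≤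
      ENNReal.ofReal (α * dist x y + weight e p β x + weight e p β y) := by
  refine (cost_le_of_variation_le hα (ν := Measure.dirac x + Measure.dirac y) ?_
    (norm_diracM_sub_le x y)).trans (le_of_eq ?_)
  · refine VectorMeasure.variation_sub_le.trans (le_of_eq ?_)
    simp [diracM, variation_diracSigned]
  · rw [lintegral_add_measure, lintegral_dirac, lintegral_dirac, mul_add, ← ofReal_weight hp hβ.le,
      ← ofReal_weight hp hβ.le, ← ENNReal.ofReal_add (weight_pos hβ x).le (weight_pos hβ y).le,
      ← ENNReal.ofReal_add (by positivity) (by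
        linarith [weight_pos (e := e) (p := p) hβ x, weight_pos (e := e) (p := p) hβ y]),
      add_assoc]

lemma cost_diracM_le (hp : 0 ≤ p) (hα : 0 < α) (hβ : 0 < β) (x : Z) :
    cost e p α β (diracM e x) ≤ ENNReal.ofReal (α * (1 + dist x e) + weight e p β x) := by
  refine (cost_le_of_variation_le hα (ν := Measure.dirac x) ?_
    (norm_diracM_le x)).trans (le_of_eq ?_)
  · simp [diracM, variation_diracSigned]
  · rw [lintegral_dirac, ← ofReal_weight hp hβ.le,
      ← ENNReal.ofReal_add (by positivity) (weight_pos hβ x).le]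

/-- The dipole `δ_x - δ_y`, scaled by the natural bound for its cost. -/
noncomputable def dipole (e : Z) (p α β : ℝ) (q : Z × Z) : momentSpace e 1 :=
  (α * dist q.1 q.2 + weight e p β q.1 + weight e p β q.2)⁻¹ • (diracM e q.1 - diracM e q.2)

/-- The Dirac measure `δ_x`, scaled by the natural bound for its cost. -/
noncomputable def monopole (e : Z) (p α β : ℝ) (x : Z) : momentSpace e 1 :=
  (α * (1 + dist x e) + weight e p β x)⁻¹ • diracM e x

/-- The measures from which minimizers are assembled: normalized dipoles and monopoles and their
negatives (exchanging the two points negates a dipole), and `0`, the limit of atoms that escape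
to infinity. -/
def atoms (e : Z) (p α β : ℝ) : Set (momentSpace e 1) :=
  insert 0 (range (dipole e p α β)) ∪
    (insert 0 (range (monopole e p α β)) ∪ insert 0 (range fun x => -monopole e p α β x))

lemma dipole_denom_pos (hα : 0 < α) (hβ : 0 < β) (x y : Z) :
    0 < α * dist x y + weight e p β x + weight e p β y := by
  have := weight_pos (e := e) (p := p) hβ x
  have := weight_pos (e := e) (p := p) hβ y
  have := mul_nonneg hα.le (dist_nonneg (x := x) (y := y))
  linarith

lemma monopole_denom_pos (hα : 0 < α) (hβ : 0 < β) (x : Z) :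
    0 < α * (1 + dist x e) + weight e p β x := by
  have := weight_pos (e := e) (p := p) hβ x
  positivity

lemma cost_inv_smul_le_one {a : ℝ} (ha : 0 < a) {μ : momentSpace e 1}
    (h : cost e p α β μ ≤ ENNReal.ofReal a) : cost e p α β (a⁻¹ • μ) ≤ 1 := by
  rw [cost_smul, abs_of_pos (inv_pos.2 ha)]
  calc _ ≤ ENNReal.ofReal a⁻¹ * ENNReal.ofReal a := by gcongr
    _ = 1 := by rw [← ENNReal.ofReal_mul (inv_pos.2 ha).le, inv_mul_cancel₀ ha.ne',
      ENNReal.ofReal_one]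

lemma cost_neg (μ : momentSpace e 1) : cost e p α β (-μ) = cost e p α β μ := by
  rw [← neg_one_smul ℝ μ, cost_smul]
  simp

lemma cost_atom_le_one (hp : 0 ≤ p) (hα : 0 < α) (hβ : 0 < β) {μ : momentSpace e 1}
    (hμ : μ ∈ atoms e p α β) : cost e p α β μ ≤ 1 := by
  have hmono (x : Z) : cost e p α β (monopole e p α β x) ≤ 1 :=
    cost_inv_smul_le_one (monopole_denom_pos hα hβ x) (cost_diracM_le hp hα hβ x)
  rcases hμ with (rfl | ⟨q, rfl⟩) | (rfl | ⟨x, rfl⟩) | (rfl | ⟨x, rfl⟩)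
  · rw [cost_zero]; exact zero_le_one
  · exact cost_inv_smul_le_one (dipole_denom_pos hα hβ _ _) (cost_diracM_sub_le hp hα hβ _ _)
  · rw [cost_zero]; exact zero_le_one
  · exact hmono x
  · rw [cost_zero]; exact zero_le_one
  · rw [cost_neg]; exact hmono x

/-- Each atom is a multiple of a dipole plus its mass at `e`: a multiple of `δ_x` is one of
`δ_x - δ_e` with its mass placed at `e`. -/
lemma exists_eq_of_mem_atoms {μ : momentSpace e 1} (hμ : μ ∈ atoms e p α β) :
    ∃ (c : ℝ) (z w : Z), (μ : SignedMeasure Z) =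
      c • (diracSigned z - diracSigned w) + (μ : SignedMeasure Z) univ • diracSigned e := by
  rcases hμ with (rfl | ⟨q, rfl⟩) | (rfl | ⟨x, rfl⟩) | (rfl | ⟨x, rfl⟩)
  · exact ⟨0, e, e, by simp⟩
  · exact ⟨_, q.1, q.2, by simp [dipole, diracM, diracSigned_univ]; rfl⟩
  · exact ⟨0, e, e, by simp⟩
  · refine ⟨(α * (1 + dist x e) + weight e p β x)⁻¹, x, e, ?_⟩
    simp [monopole, diracM, diracSigned_univ, smul_sub]
  · exact ⟨0, e, e, by simp⟩
  · refine ⟨-(α * (1 + dist x e) + weight e p β x)⁻¹, x, e, ?_⟩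
    simp [monopole, diracM, diracSigned_univ, smul_sub]
    module

/-- Since `p > 1`, a family of measures whose norm grows linearly and whose scaling decays like
`M ^ (-p)` vanishes at infinity. -/
lemma tendsto_zero_of_norm_le {X : Type*} {l : Filter X} {E : Type*} [NormedAddCommGroup E]
    {f : X → E} {M : X → ℝ} (hp : 1 < p) (hM : Tendsto M l atTop) {C : ℝ}
    (hf : ∀ x, 1 ≤ M x → ‖f x‖ ≤ C * (M x * (M x ^ p)⁻¹)) : Tendsto f l (𝓝 0) := by
  have h1 : Tendsto (fun x => C * M x ^ (-(p - 1))) l (𝓝 0) := by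
    simpa using ((tendsto_rpow_neg_atTop (sub_pos.2 hp)).comp hM).const_mul C
  refine squeeze_zero_norm' ?_ h1
  filter_upwards [hM.eventually_ge_atTop 1] with x hx
  refine (hf x hx).trans (le_of_eq ?_)
  rw [neg_sub, Real.rpow_sub (by linarith), Real.rpow_one, div_eq_mul_inv]

/-- The decay estimate shared by dipoles and monopoles. -/
lemma norm_inv_smul_le {E : Type*} [NormedAddCommGroup E] [NormedSpace ℝ E] {a M : ℝ} {v : E}
    (hβ : 0 < β) (hM : 1 ≤ M) (ha : β * M ^ p ≤ a) (hv : ‖v‖ ≤ 2 * M) :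
    ‖a⁻¹ • v‖ ≤ 2 / β * (M * (M ^ p)⁻¹) := by
  have h0 : 0 < M ^ p := Real.rpow_pos_of_pos (by linarith) p
  have ha0 : 0 < β * M ^ p := by positivity
  rw [norm_smul, norm_inv, Real.norm_of_nonneg (ha0.le.trans ha)]
  calc a⁻¹ * ‖v‖ ≤ (β * M ^ p)⁻¹ * (2 * M) := by gcongr
    _ = 2 / β * (M * (M ^ p)⁻¹) := by field_simp

lemma mul_rpow_le_weight (hβ : 0 < β) (z : Z) : β * dist z e ^ p ≤ weight e p β z := by
  rw [weight]; linarith [mul_add β 1 (dist z e ^ p)]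

lemma tendsto_dipole [ProperSpace Z] (hp : 1 < p) (hα : 0 < α) (hβ : 0 < β) :
    Tendsto (dipole e p α β) (cocompact (Z × Z)) (𝓝 0) := by
  refine tendsto_zero_of_norm_le (M := fun q => dist q (e, e)) (C := 2 / β) hp
    (tendsto_dist_right_cocompact_atTop _) fun q hq => norm_inv_smul_le hβ hq ?_ ?_
  · have h1 := weight_pos (e := e) (p := p) hβ q.1
    have h2 := weight_pos (e := e) (p := p) hβ q.2
    have h3 := mul_rpow_le_weight (e := e) (p := p) hβ q.1
    have h4 := mul_rpow_le_weight (e := e) (p := p) hβ q.2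
    have h5 := mul_nonneg hα.le (dist_nonneg (x := q.1) (y := q.2))
    rw [Prod.dist_eq]
    rcases max_choice (dist q.1 e) (dist q.2 e) with h | h <;> simp only [h] <;> linarith
  · refine (norm_diracM_sub_le _ _).trans ?_
    rw [Prod.dist_eq]
    have h1 := le_max_left (dist q.1 e) (dist q.2 e)
    have h2 := le_max_right (dist q.1 e) (dist q.2 e)
    have h3 := dist_triangle_right q.1 q.2 e
    simp only
    linarith

lemma tendsto_monopole [ProperSpace Z] (hp : 1 < p) (hα : 0 < α) (hβ : 0 < β) :
    Tendsto (monopole e p α β) (cocompact Z) (𝓝 0) := by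
  refine tendsto_zero_of_norm_le (M := fun q => dist q e) (C := 2 / β) hp
    (tendsto_dist_right_cocompact_atTop _) fun q hq => norm_inv_smul_le hβ hq ?_ ?_
  · have h3 := mul_rpow_le_weight (e := e) (p := p) hβ q
    have h5 : 0 ≤ α * (1 + dist q e) := by positivity
    linarith
  · exact (norm_diracM_le _).trans (by linarith)

lemma continuous_diracM : Continuous (diracM e) := lipschitzWith_diracM.continuous

lemma continuous_dipole (hp : 0 ≤ p) (hα : 0 < α) (hβ : 0 < β) :
    Continuous (dipole e p α β) := by
  have hw := continuous_weight (e := e) (β := β) hp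
  have hd := continuous_diracM (e := e)
  refine Continuous.smul (Continuous.inv₀ (by fun_prop) fun q => (dipole_denom_pos hα hβ _ _).ne')
    (by fun_prop)

lemma continuous_monopole (hp : 0 ≤ p) (hα : 0 < α) (hβ : 0 < β) :
    Continuous (monopole e p α β) := by
  have hw := continuous_weight (e := e) (β := β) hp
  exact Continuous.smul (Continuous.inv₀ (by fun_prop) fun q => (monopole_denom_pos hα hβ _).ne')
    continuous_diracM

/-- The set of atoms is compact: this is where properness of `Z` and `p > 1` enter. -/
theorem isCompact_atoms [ProperSpace Z] (hp : 1 < p) (hα : 0 < α) (hβ : 0 < β) :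
    IsCompact (atoms e p α β) := by
  have hp0 : 0 ≤ p := by linarith
  refine ((tendsto_dipole hp hα hβ).isCompact_insert_range_of_cocompact
    (continuous_dipole hp0 hα hβ)).union
    (((tendsto_monopole hp hα hβ).isCompact_insert_range_of_cocompact
    (continuous_monopole hp0 hα hβ)).union (Tendsto.isCompact_insert_range_of_cocompact ?_
    (continuous_monopole hp0 hα hβ).neg))
  simpa using (tendsto_monopole (e := e) hp hα hβ).neg

/-! ### Duality -/

/-- Homogeneity of the dual norm in the Lipschitz constant, with `L = 0` allowed. -/
lemma pairing_le_mul_sSup {L : ℝ≥0} {v : Z → ℝ} (hv : LipschitzWith L v) (hve : v e = 0)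
    (μ : momentSpace e 1) :
    pairing v μ ≤ L * sSup ((fun f => pairing f (μ : SignedMeasure Z)) '' unitLip₀ e) := by
  rcases eq_or_ne L 0 with rfl | hL
  · have : v = fun _ => 0 := by
      ext z
      have := hv.dist_le_mul z e
      simpa [hve] using this
    rw [this]
    simp [pairing, VectorMeasure.integral_zero]
  · have hL0 : (0 : ℝ) < L := by positivity
    have hmem : (L : ℝ)⁻¹ • v ∈ unitLip₀ e := by
      refine ⟨LipschitzWith.of_dist_le_mul fun x y => ?_, by simp [hve]⟩
      have := hv.dist_le_mul x y
      rw [Pi.smul_apply, Pi.smul_apply, dist_smul₀, norm_inv, Real.norm_of_nonneg hL0.le,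
        inv_mul_le_iff₀ hL0]
      simpa using this
    have h := pairing_le μ.2 hmem
    rw [pairing, VectorMeasure.integral_smul, smul_eq_mul, inv_mul_le_iff₀ hL0] at h
    exact h

lemma integrable_of_lipschitzWith {K : ℝ≥0} {φ : Z → ℝ} (hφ : LipschitzWith K φ)
    (μ : momentSpace e 1) : VectorMeasure.Integrable (μ : SignedMeasure Z) φ := by
  refine ⟨hφ.continuous.measurable.aestronglyMeasurable, ?_⟩
  have hle : ∀ z, ‖φ z‖ₑ ≤ ‖φ e‖ₑ + K * edist z e ^ (1 : ℝ) := by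
    intro z
    rw [ENNReal.rpow_one]
    calc ‖φ z‖ₑ = ‖φ e + (φ z - φ e)‖ₑ := by congr 1; ring
      _ ≤ ‖φ e‖ₑ + ‖φ z - φ e‖ₑ := enorm_add_le _ _
      _ ≤ _ := by
        rw [← edist_eq_enorm_sub]
        gcongr
        exact hφ z e
  refine (lintegral_mono hle).trans_lt ?_
  rw [lintegral_add_left measurable_const, lintegral_const, lintegral_const_mul' _ _ (by simp)]
  exact ENNReal.add_lt_top.2 ⟨ENNReal.mul_lt_top (by simp) (measure_lt_top _ _),
    ENNReal.mul_lt_top (by simp) μ.2⟩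

/-- A Lipschitz function that is bounded by `s` on atoms is bounded by `s` times the cost on all
measures: up to an error of at most `s` times the weight, it is an `s α`-Lipschitz function whose
value at `e` is at most `s α` in absolute value, and such functions are controlled by
`s α ‖μ‖`. -/
theorem pairing_le_mul_cost (hp : 0 ≤ p) (hα : 0 < α) (hβ : 0 < β) {K : ℝ≥0} {φ : Z → ℝ}
    (hφ : LipschitzWith K φ) {s : ℝ} (hs : 0 ≤ s)
    (h1 : ∀ x y, φ x - φ y ≤ s * (α * dist x y + weight e p β x + weight e p β y))
    (h2 : ∀ x, |φ x| ≤ s * (α * (1 + dist x e) + weight e p β x))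
    (μ : momentSpace e 1) (hμ : cost e p α β μ < ∞) :
    pairing φ μ ≤ s * (cost e p α β μ).toReal := by
  set L : ℝ≥0 := ⟨s * α, by positivity⟩ with hL
  have hLc : (L : ℝ) = s * α := rfl
  obtain ⟨u, huL, hlu, huh⟩ := exists_lipschitzWith_between (X := Z) L
    (l := fun x => max (φ x - s * weight e p β x) (-(s * α * (1 + dist x e))))
    (h := fun x => min (φ x + s * weight e p β x) (s * α * (1 + dist x e))) (by
      intro x y
      have hx := (abs_le.1 (h2 x)).2
      have hy := (abs_le.1 (h2 y)).1
      have hxy := h1 x y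
      have t1 := mul_le_mul_of_nonneg_left (dist_triangle x y e) (show 0 ≤ s * α by positivity)
      have t2 := mul_le_mul_of_nonneg_left (dist_triangle_left y e x) (show 0 ≤ s * α by positivity)
      have t3 : 0 ≤ s * α * dist x y := by positivity
      have t4 : 0 ≤ s * α * dist x e := by positivity
      have t5 : 0 ≤ s * α * dist y e := by positivity
      have t6 : 0 ≤ s * α := by positivity
      rw [hLc, ← min_add_add_right, max_le_iff, le_min_iff, le_min_iff]
      refine ⟨⟨?_, ?_⟩, ?_, ?_⟩ <;> nlinarith)
  have hu1 : ∀ x, |φ x - u x| ≤ s * weight e p β x := fun x => by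
    have a := (le_max_left _ _).trans (hlu x)
    have b := (huh x).trans (min_le_left _ _)
    exact abs_le.2 ⟨by linarith, by linarith⟩
  have hu2 : |u e| ≤ s * α := by
    have a := (le_max_right _ _).trans (hlu e)
    have b := (huh e).trans (min_le_right _ _)
    simp only [dist_self, add_zero, mul_one] at a b
    exact abs_le.2 ⟨a, b⟩
  set v : Z → ℝ := fun z => u z - u e with hv
  have hvL : LipschitzWith L v := LipschitzWith.of_dist_le_mul fun x y => by
    simpa [hv, dist_eq_norm] using huL.dist_le_mul x y
  have hiφ := integrable_of_lipschitzWith hφ μ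
  have hiu := integrable_of_lipschitzWith huL μ
  have hiv := integrable_of_lipschitzWith hvL μ
  -- the decomposition `φ = (φ - u) + v + u e`
  have hsplit : pairing φ μ = pairing (fun z => φ z - u z) μ + pairing v μ +
      u e * (μ : SignedMeasure Z) univ := by
    have hc : pairing (fun _ : Z => u e) (μ : SignedMeasure Z) =
        u e * (μ : SignedMeasure Z) univ := by
      simp [pairing, VectorMeasure.integral_const]
    rw [← hc]
    simp only [pairing]
    have hiw : VectorMeasure.Integrable (μ : SignedMeasure Z) fun z => φ z - u z := hiφ.sub hiu
    have hiwv : VectorMeasure.Integrable (μ : SignedMeasure Z) fun z => φ z - u z + v z :=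
      hiw.add hiv
    rw [← VectorMeasure.integral_fun_add hiw hiv,
      ← VectorMeasure.integral_fun_add hiwv (integrable_const _)]
    congr 1
    ext z
    simp [hv]
  set W := ENNReal.ofReal β * ∫⁻ z, (1 + edist z e ^ p) ∂(μ : SignedMeasure Z).variation with hW
  have hcost : cost e p α β μ = ENNReal.ofReal (α * ‖μ‖) + W := rfl
  have hWtop : W ≠ ∞ := by
    rw [hcost] at hμ
    exact (ENNReal.add_lt_top.1 hμ).2.ne
  have b1 : pairing (fun z => φ z - u z) μ ≤ s * W.toReal := by
    have h := VectorMeasure.enorm_integral_le_lintegral_enorm_transpose (μ := (μ : SignedMeasure Z))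
      (f := fun z => φ z - u z) (B := ContinuousLinearMap.lsmul ℝ ℝ)
    rw [VectorMeasure.variation_transpose_lsmul] at h
    have h' : ∫⁻ z, ‖φ z - u z‖ₑ ∂(μ : SignedMeasure Z).variation ≤ ENNReal.ofReal s * W := by
      rw [hW, ← lintegral_const_mul' _ _ ENNReal.ofReal_ne_top,
        ← lintegral_const_mul' _ _ ENNReal.ofReal_ne_top]
      refine lintegral_mono fun z => ?_
      rw [← ofReal_weight hp hβ.le, ← ENNReal.ofReal_mul hs, ← ofReal_norm]
      exact ENNReal.ofReal_le_ofReal (hu1 z)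
    have h'' := ENNReal.toReal_mono (ENNReal.mul_ne_top ENNReal.ofReal_ne_top hWtop) (h.trans h')
    rw [toReal_enorm, ENNReal.toReal_mul, ENNReal.toReal_ofReal hs] at h''
    exact (le_abs_self _).trans h''
  have b2 := pairing_le_mul_sSup hvL (by simp [hv]) μ
  have b3 : u e * (μ : SignedMeasure Z) univ ≤ s * α * |(μ : SignedMeasure Z) univ| := by
    refine (le_abs_self _).trans ?_
    rw [abs_mul]
    gcongr
  rw [hsplit, hcost, ENNReal.toReal_add ENNReal.ofReal_ne_top hWtop,
    ENNReal.toReal_ofReal (by positivity), norm_eq_kruNorm, kruNorm]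
  rw [hLc] at b2
  linarith

/-! ### The image of the cost ball -/

variable {H : Type*} [NormedAddCommGroup H] [NormedSpace ℝ H]

/-- The values of `A` at the atoms. -/
def atomValues (e : Z) (p α β : ℝ) (A : KRuSpace e →L[ℝ] H) : Set H :=
  (fun μ : momentSpace e 1 => A (μ : KRuSpace e)) '' atoms e p α β

lemma zero_mem_atomValues (A : KRuSpace e →L[ℝ] H) : (0 : H) ∈ atomValues e p α β A :=
  ⟨0, Or.inl (mem_insert _ _), by
    dsimp only; rw [UniformSpace.Completion.coe_zero, map_zero]⟩

lemma isCompact_atomValues [ProperSpace Z] (hp : 1 < p) (hα : 0 < α) (hβ : 0 < β)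
    (A : KRuSpace e →L[ℝ] H) : IsCompact (atomValues e p α β A) :=
  (isCompact_atoms hp hα hβ).image
    (A.continuous.comp (UniformSpace.Completion.continuous_coe _))

lemma lipschitzWith_clm_diracM (L : KRuSpace e →L[ℝ] ℝ) :
    LipschitzWith ‖L‖₊ fun z => L (diracM e z) := by
  have h : LipschitzWith 1 fun z => (diracM e z : KRuSpace e) :=
    LipschitzWith.of_dist_le_mul fun x y => by
      rw [UniformSpace.Completion.dist_eq]
      exact lipschitzWith_diracM.dist_le_mul x y
  have hL := L.lipschitz.comp h
  rw [mul_one] at hL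
  exact hL

/-- A continuous functional that is at most `s` on atoms is at most `s` times the cost on all
measures of finite cost. -/
lemma clm_le_mul_cost [TopologicalSpace.SeparableSpace Z] (hp : 0 ≤ p) (hα : 0 < α) (hβ : 0 < β)
    (L : KRuSpace e →L[ℝ] ℝ) {s : ℝ} (hL : ∀ ω ∈ atoms e p α β, L (ω : KRuSpace e) ≤ s)
    (μ : momentSpace e 1) (hμ : cost e p α β μ < ∞) :
    L μ ≤ s * (cost e p α β μ).toReal := by
  have hs : 0 ≤ s := by
    have := hL 0 (Or.inl (mem_insert _ _))
    rwa [UniformSpace.Completion.coe_zero, map_zero] at this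
  have hmono (x : Z) : L (monopole e p α β x : KRuSpace e) =
      (α * (1 + dist x e) + weight e p β x)⁻¹ * L (diracM e x : KRuSpace e) := by
    rw [monopole, UniformSpace.Completion.coe_smul, map_smul, smul_eq_mul]
  rw [clm_apply_eq_pairing]
  refine pairing_le_mul_cost hp hα hβ (lipschitzWith_clm_diracM L) hs (fun x y => ?_) (fun x => ?_)
    μ hμ
  · have h := hL _ (Or.inl (mem_insert_of_mem _ ⟨(x, y), rfl⟩))
    rw [dipole, UniformSpace.Completion.coe_smul, map_smul, UniformSpace.Completion.coe_sub,
      map_sub, smul_eq_mul, inv_mul_le_iff₀ (dipole_denom_pos hα hβ _ _), mul_comm] at h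
    exact h
  · have h := hL _ (Or.inr (Or.inl (mem_insert_of_mem _ ⟨x, rfl⟩)))
    have h' := hL _ (Or.inr (Or.inr (mem_insert_of_mem _ ⟨x, rfl⟩)))
    rw [hmono, inv_mul_le_iff₀ (monopole_denom_pos hα hβ _), mul_comm] at h
    rw [UniformSpace.Completion.coe_neg, map_neg, hmono, ← mul_neg,
      inv_mul_le_iff₀ (monopole_denom_pos hα hβ _), mul_comm] at h'
    exact abs_le'.2 ⟨h, h'⟩

/-- Observing a measure of cost `g` gives `g` times a convex combination of observed atoms:
otherwise a linear functional would separate the two, contradicting `clm_le_mul_cost`. -/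
theorem exists_eq_smul_of_cost [ProperSpace Z] [TopologicalSpace.SeparableSpace Z]
    [FiniteDimensional ℝ H] (hp : 1 < p) (hα : 0 < α) (hβ : 0 < β) (A : KRuSpace e →L[ℝ] H)
    (μ : momentSpace e 1) (hμ : cost e p α β μ < ∞) :
    ∃ b ∈ convexHull ℝ (atomValues e p α β A), A μ = (cost e p α β μ).toReal • b := by
  set T := atomValues e p α β A with hT
  set g := (cost e p α β μ).toReal with hg
  have hg0 : 0 ≤ g := ENNReal.toReal_nonneg
  have hcT : IsCompact T := isCompact_atomValues hp hα hβ A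
  have hcomp : IsCompact (convexHull ℝ T) :=
    isCompact_convexHull_of_zero_mem (zero_mem_atomValues A) hcT
  by_contra! hne
  obtain ⟨f, u, hfu, hu⟩ := geometric_hahn_banach_closed_point (E := H)
    ((convex_convexHull ℝ T).smul g) (hcomp.smul g).isClosed (x := A μ) (by
      rintro ⟨b, hb, hbμ⟩
      exact hne b hb hbμ.symm)
  obtain ⟨t, ht, hmax⟩ := hcT.exists_isMaxOn ⟨0, zero_mem_atomValues A⟩ f.continuous.continuousOn
  have h1 : (f.comp A) μ ≤ f t * g := clm_le_mul_cost (by linarith) hα hβ _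
    (fun ω hω => hmax (mem_image_of_mem _ hω)) μ hμ
  have h2 := hfu (g • t) (smul_mem_smul_set (subset_convexHull ℝ T ht))
  rw [map_smul, smul_eq_mul] at h2
  rw [ContinuousLinearMap.comp_apply] at h1
  linarith

/-- Every nonnegative multiple `r • b` of a convex combination of observed atoms is the
observation of a measure assembled from at most `dim H` atoms, of cost at most `r`. -/
theorem exists_measure_of_mem_convexHull [FiniteDimensional ℝ H] (hp : 0 ≤ p) (hα : 0 < α)
    (hβ : 0 < β) (A : KRuSpace e →L[ℝ] H) {N : ℕ} (hN : Module.finrank ℝ H ≤ N) {r : ℝ}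
    (hr : 0 ≤ r) {b : H} (hb : b ∈ convexHull ℝ (atomValues e p α β A)) :
    ∃ μ : momentSpace e 1, A (μ : KRuSpace e) = r • b ∧ cost e p α β μ ≤ ENNReal.ofReal r ∧
      ∃ (c : Fin N → ℝ) (z w : Fin N → Z), (μ : SignedMeasure Z) =
        ∑ i, c i • (diracSigned (z i) - diracSigned (w i)) +
          (μ : SignedMeasure Z) univ • diracSigned e := by
  obtain ⟨c, t, hc0, hc1, ht, rfl⟩ :=
    exists_sum_smul_of_mem_convexHull (zero_mem_atomValues A) hb hN
  choose ω hω hωt using ht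
  choose a z w hzw using fun i => exists_eq_of_mem_atoms (hω i)
  refine ⟨∑ i, (r * c i) • ω i, ?_, ?_, fun i => r * c i * a i, z, w, ?_⟩
  · have : ((∑ i, (r * c i) • ω i : momentSpace e 1) : KRuSpace e) =
        ∑ i, (r * c i) • (ω i : KRuSpace e) := by
      have := map_sum (UniformSpace.Completion.toComplL (𝕜 := ℝ) (E := momentSpace e 1))
        (fun i => (r * c i) • ω i) Finset.univ
      simp only [map_smul] at this
      exact this
    rw [this, map_sum, Finset.smul_sum]
    refine Finset.sum_congr rfl fun i _ => ?_
    rw [map_smul, mul_smul, ← hωt]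
  · calc cost e p α β (∑ i, (r * c i) • ω i) ≤ ∑ i, cost e p α β ((r * c i) • ω i) :=
          cost_sum_le hα _ _
      _ ≤ ∑ i, ENNReal.ofReal (r * c i) := by
          refine Finset.sum_le_sum fun i _ => ?_
          rw [cost_smul, abs_of_nonneg (mul_nonneg hr (hc0 i))]
          exact mul_le_of_le_one_right' (cost_atom_le_one hp hα hβ (hω i))
      _ = ENNReal.ofReal (r * ∑ i, c i) := by
          rw [Finset.mul_sum, ENNReal.ofReal_sum_of_nonneg fun i _ => mul_nonneg hr (hc0 i)]
      _ ≤ ENNReal.ofReal r := ENNReal.ofReal_le_ofReal (mul_le_of_le_one_right hr hc1)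
  · have hcoe : ((∑ i, (r * c i) • ω i : momentSpace e 1) : SignedMeasure Z) =
        ∑ i, (r * c i) • (ω i : SignedMeasure Z) := by simp
    have huniv : (∑ i, (r * c i) • (ω i : SignedMeasure Z)) univ =
        ∑ i, r * c i * (ω i : SignedMeasure Z) univ := by
      simp
    rw [hcoe, huniv, Finset.sum_smul, ← Finset.sum_add_distrib]
    refine Finset.sum_congr rfl fun i _ => ?_
    conv_lhs => rw [hzw i]
    rw [smul_add, smul_smul, smul_smul]

end KRu

theorem mainTheorem3 {Z : Type*} [MetricSpace Z] [CompleteSpace Z]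
    [TopologicalSpace.SeparableSpace Z] [LocallyCompactSpace Z]
    [MeasurableSpace Z] [BorelSpace Z] (hZ : KRu.IsGeodesic Z) (e : Z)
    (N : ℕ) (p α β : ℝ) (hp : 1 < p) (hα : 0 < α) (hβ : 0 < β)
    (A : KRu.KRuSpace e →L[ℝ] EuclideanSpace ℝ (Fin N))
    (F : EuclideanSpace ℝ (Fin N) → EReal)
    (hF_bot : ∀ y, F y ≠ ⊥) (hF_proper : ∃ y, F y ≠ ⊤)
    (hF_convex : KRu.IsConvex F) (hF_coercive : KRu.IsCoercive F)
    (hF_lsc : LowerSemicontinuous F) :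
    ∃ μ : KRu.momentSpace e 1,
      (μ : SignedMeasure Z) ∈ KRu.momentSpace e p ∧
      (∀ x : KRu.KRuSpace e,
        KRu.objective e p α β A F (μ : KRu.KRuSpace e) ≤ KRu.objective e p α β A F x) ∧
      ∃ (c : Fin N → ℝ) (z w : Fin N → Z),
        (μ : SignedMeasure Z) =
          ∑ i, c i • (KRu.diracSigned (z i) - KRu.diracSigned (w i)) +
            (μ : SignedMeasure Z) univ • KRu.diracSigned e := by
  have hproper : ProperSpace Z := hZ.properSpace e
  have hp0 : 0 ≤ p := by linarith
  have h0 := KRu.zero_mem_atomValues (p := p) (α := α) (β := β) A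
  obtain ⟨m, hm⟩ := hF_coercive.exists_le hF_lsc hF_bot
  obtain ⟨r, hr, b, hb, hmin⟩ := KRu.exists_min_add_smul hF_lsc hm
    (KRu.isCompact_convexHull_of_zero_mem h0 (KRu.isCompact_atomValues hp hα hβ A))
    ⟨0, subset_convexHull ℝ _ h0⟩
  obtain ⟨μ, hAμ, hcost, hform⟩ := KRu.exists_measure_of_mem_convexHull hp0 hα hβ A
    (N := N) (by simp) hr hb
  have hμp := (KRu.cost_lt_top_iff hβ μ).1 (hcost.trans_lt ENNReal.ofReal_lt_top)
  refine ⟨μ, hμp, fun x => ?_, hform⟩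
  have hcoe : ∀ ν : KRu.momentSpace e 1, (ν : SignedMeasure Z) ∈ KRu.momentSpace e p →
      KRu.regularizer e p α β (ν : KRu.KRuSpace e) = KRu.cost e p α β ν :=
    fun ν hν => KRu.regularizer_coe e p α β ν hν
  by_cases hx : ∃ ν : KRu.momentSpace e 1, (ν : SignedMeasure Z) ∈ KRu.momentSpace e p ∧
      (ν : KRu.KRuSpace e) = x
  · obtain ⟨ν, hν, rfl⟩ := hx
    have hνtop := (KRu.cost_lt_top_iff (α := α) hβ ν).2 hν
    obtain ⟨b', hb', hAν⟩ := KRu.exists_eq_smul_of_cost hp hα hβ A ν hνtop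
    have key := hmin (KRu.cost e p α β ν).toReal ENNReal.toReal_nonneg b' hb'
    rw [← hAν, ← hAμ] at key
    rw [KRu.objective, KRu.objective, hcoe μ hμp, hcoe ν hν]
    calc F (A μ) + (KRu.cost e p α β μ : EReal) ≤ F (A μ) + (r : EReal) := by
          gcongr
          refine (EReal.coe_ennreal_le_coe_ennreal_iff.2 hcost).trans (le_of_eq ?_)
          rw [EReal.coe_ennreal_ofReal, max_eq_left hr]
      _ ≤ _ := key
      _ = F (A ν) + (KRu.cost e p α β ν : EReal) := by
          rw [EReal.coe_ennreal_toReal hνtop.ne]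
  · push Not at hx
    rw [KRu.objective, KRu.objective, KRu.regularizer_eq_top e p α β x hx,
      EReal.coe_ennreal_top, EReal.add_top_of_ne_bot (hF_bot _)]
    exact le_top
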